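/- **Definitions.** An *effect algebra* is a set $\mathcal E$ with distinct elements $0,1$ and a partial binary operation $\oplus$ (write $a\perp b$ when $a\oplus b$ is defined) such that: (E1) if $a\perp b$ then $b\perp a$ and $b\oplus a=a\oplus b$; (E2) if $a\perp b$ and $(a\oplus b)\perp c$ then $b\perp c$, $a\perp(b\oplus c)$ and $a\oplus(b\oplus c)=(a\oplus b)\oplus c$; (E3) for each $a$ there is a unique $a'$ with $a\perp a'$ and $a\oplus a'=1$; (E4) if $a\perp 1$ then $a=0$. Write $a\le b$ if $a\oplus c=b$ for some $c$. It is *convex* if it carries a multiplication by scalars $\lambda\in[0,1]$ with $\alpha(\beta a)=(\alpha\beta)a$; $\alpha a\perp\beta a$ and $(\alpha+\beta)a=\alpha a\oplus\beta a$ if $\alpha+\beta\le 1$; $\lambda a\perp\lambda b$ and $\lambda(a\oplus b)=\lambda a\oplus\lambda b$ if $a\perp b$; and $1a=a$. A *convex sequential effect algebra* (convex SEA) is a convex effect algebra with an operation $\circ:\mathcal E\times\mathcal E\to\mathcal E$ such that, writing $a|b$ for $a\circ b=b\circ a$: (S1) $b\perp c$ implies $a\circ b\perp a\circ c$ and $a\circ(b\oplus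 c)=a\circ b\oplus a\circ c$; (S2) $1\circ a=a$; (S3) $a\circ b=0$ implies $a|b$; (S4) $a|b$ implies $a|b'$ and $a\circ(b\circ c)=(a\circ b)\circ c$ for all $c$; (S5) $c|a$ and $c|b$ imply $c|(a\circ b)$, and $c|(a\oplus b)$ whenever $a\perp b$; (S6) $(\lambda a)\circ b=a\circ(\lambda b)=\lambda(a\circ b)$ for $\lambda\in[0,1]$. An element $a$ is *sharp* if $a\wedge a'=0$. Let $S_1(\mathcal E)$ be the set of sharp $a\ne0$ such that every $b\le a$ is of the form $\lambda a$, $\lambda\in[0,1]$. A *context* is a finite set $\mathcal A=\{a_1,\dots,a_n\}\subseteq S_1(\mathcal E)$ with $a_1\oplus\cdots\oplus a_n=1$. $\mathcal E$ is *spectral* if every $b\in\mathcal E$ is $b=\lambda_1a_1\oplus\cdots\oplus\lambda_na_n$ for some context $\{a_1,\dots,a_n\}$ and some $\lambda_i\in[0,1]$. A *state* is a map $\omega:\mathcal E\to[0,1]$ with $\omega(1)=1$ and $\omega(a\oplus b)=\omega(a)+\omega(b)$ whenever $a\perp b$. For each $a\in S_1(\mathcal E)$ fix a state $\widehat a$ with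 $\widehat a(a)=1$. For a context $\mathcal A$ let $\mathcal H(\mathcal A)$ be the complex Hilbert space with orthonormal basis $\{\widehat a: a\in\mathcal A\}$. The set of all contexts is *complete* if there are unitary maps $U_{\mathcal A\mathcal B}:\mathcal H(\mathcal A)\to\mathcal H(\mathcal B)$, for all contexts $\mathcal A,\mathcal B$, with $U_{\mathcal A\mathcal A}=I$, $U_{\mathcal A\mathcal B}=U_{\mathcal B\mathcal A}^*$ and $|\langle U_{\mathcal A\mathcal B}\widehat a,U_{\mathcal C\mathcal B}\widehat c\rangle|^2=\widehat a(c)$ for all contexts $\mathcal A,\mathcal B,\mathcal C$ and $a\in\mathcal A$, $c\in\mathcal C$, and such that for every context $\mathcal B$ and every unit vector $\phi\in\mathcal H(\mathcal B)$ there are a context $\mathcal A$ and $a\in\mathcal A$ with $U_{\mathcal A\mathcal B}\widehat a=z\phi$ for some $z\in\mathbb C$, $|z|=1$. **Statement.** Let $\mathcal E$ be a spectral convex SEA whose set of contexts is complete, with states $\widehat a$ and unitaries $U_{\mathcal A\mathcal B}$ as above, and fix a context $\mathcal B$. For $b\in\mathcal E$ put $$J(b)=\sum_i\lambda_iP(U_{\mathcal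 A\mathcal B}\widehat a_i),$$ an operator on $\mathcal H(\mathcal B)$, where $b=\lambda_1a_1\oplus\cdots\oplus\lambda_na_n$ with $\mathcal A=\{a_1,\dots,a_n\}$ a context and $\lambda_i\in[0,1]$ (one such decomposition being chosen for each $b$), and where $P(v)$ denotes the orthogonal projection onto $\mathbb Cv$. Then for all $a,b\in\mathcal E$: 1. $a|b$ if and only if $J(a)J(b)=J(b)J(a)$; 2. if $a|b$, then $J(a\circ b)=J(a)J(b)$. -/

import Mathlib

open scoped unitInterval

/-- An effect algebra. The partial operation is encoded by its domain `Perp` and a function `oplus`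
whose values are only meaningful (and only constrained or used) on pairs with `Perp a b`. -/
class EffectAlgebra (E : Type*) extends Zero E, One E where
  Perp : E → E → Prop
  oplus : E → E → E
  compl : E → E
  zero_ne_one : (0 : E) ≠ 1
  perp_symm : ∀ a b, Perp a b → Perp b a
  oplus_comm : ∀ a b, Perp a b → oplus b a = oplus a b
  perp_of_oplus_perp : ∀ a b c, Perp a b → Perp (oplus a b) c → Perp b c
  perp_oplus_of_oplus_perp : ∀ a b c, Perp a b → Perp (oplus a b) c → Perp a (oplus b c)
  oplus_assoc : ∀ a b c, Perp a b → Perp (oplus a b) c →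
    oplus a (oplus b c) = oplus (oplus a b) c
  perp_compl : ∀ a, Perp a (compl a)
  oplus_compl : ∀ a, oplus a (compl a) = 1
  compl_unique : ∀ a b, Perp a b → oplus a b = 1 → b = compl a
  eq_zero_of_perp_one : ∀ a, Perp a 1 → a = 0

/-- A convex effect algebra: multiplication by scalars in `[0,1]`. -/
class ConvexEffectAlgebra (E : Type*) extends EffectAlgebra E, SMul I E where
  smul_smul : ∀ (α β : I) (a : E), α • (β • a) = (α * β) • a
  add_smul_perp : ∀ (α β γ : I) (a : E), (α : ℝ) + β = γ → Perp (α • a) (β • a)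
  add_smul : ∀ (α β γ : I) (a : E), (α : ℝ) + β = γ → γ • a = oplus (α • a) (β • a)
  smul_perp : ∀ (α : I) (a b : E), Perp a b → Perp (α • a) (α • b)
  smul_oplus : ∀ (α : I) (a b : E), Perp a b → α • oplus a b = oplus (α • a) (α • b)
  one_smul : ∀ a : E, (1 : I) • a = a

/-- A convex sequential effect algebra (convex SEA); `seq a b` is the product `a ∘ b`, and
`seq a b = seq b a` is the relation `a | b`. -/
class ConvexSEA (E : Type*) extends ConvexEffectAlgebra E where
  seq : E → E → E
  seq_perp : ∀ a b c, Perp b c → Perp (seq a b) (seq a c)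
  seq_oplus : ∀ a b c, Perp b c → seq a (oplus b c) = oplus (seq a b) (seq a c)
  one_seq : ∀ a, seq 1 a = a
  comm_of_seq_eq_zero : ∀ a b, seq a b = 0 → seq a b = seq b a
  comm_compl : ∀ a b, seq a b = seq b a → seq a (compl b) = seq (compl b) a
  seq_assoc : ∀ a b c, seq a b = seq b a → seq a (seq b c) = seq (seq a b) c
  comm_seq : ∀ a b c, seq c a = seq a c → seq c b = seq b c →
    seq c (seq a b) = seq (seq a b) c
  comm_oplus : ∀ a b c, seq c a = seq a c → seq c b = seq b c → Perp a b →
    seq c (oplus a b) = seq (oplus a b) c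
  smul_seq : ∀ (α : I) (a b : E), seq (α • a) b = α • seq a b
  seq_smul : ∀ (α : I) (a b : E), seq a (α • b) = α • seq a b

namespace EffectAlgebra

/-- The order of an effect algebra: `a ≤ b` iff `a ⊕ c = b` for some `c`. -/
def Le {E : Type*} [EffectAlgebra E] (a b : E) : Prop :=
  ∃ c, Perp a c ∧ oplus a c = b

/-- `a` is sharp: the greatest lower bound `a ∧ a'` exists and is `0`
(`0` is a lower bound of every pair). -/
def IsSharp {E : Type*} [EffectAlgebra E] (a : E) : Prop :=
  ∀ b, Le b a → Le b (compl a) → Le b 0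

/-- `HasOrthoSum f s x`: the orthogonal sum of the family `f` over the finite set `s` is defined,
and equals `x` (the sum being formed by adding one term at a time, in some order). -/
inductive HasOrthoSum {E : Type*} [EffectAlgebra E] {ι : Type*} (f : ι → E) :
    Finset ι → E → Prop
  | empty : HasOrthoSum f ∅ 0
  | cons (i : ι) (s : Finset ι) (hi : i ∉ s) (x : E) :
      HasOrthoSum f s x → Perp (f i) x → HasOrthoSum f (Finset.cons i s hi) (oplus (f i) x)

/-- A state: an additive map `E → [0,1]` with value `1` at `1`. -/
structure State (E : Type*) [EffectAlgebra E] where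
  toFun : E → I
  map_oplus : ∀ a b, Perp a b → (toFun (oplus a b) : ℝ) = toFun a + toFun b
  map_one : toFun 1 = 1

end EffectAlgebra

namespace ConvexEffectAlgebra

open EffectAlgebra

/-- One-dimensional sharp effects. -/
def IsOneDim {E : Type*} [ConvexEffectAlgebra E] (a : E) : Prop :=
  IsSharp a ∧ a ≠ 0 ∧ ∀ b, Le b a → ∃ t : I, b = t • a

/-- The set `S₁(E)` of one-dimensional sharp effects. -/
abbrev S1 (E : Type*) [ConvexEffectAlgebra E] : Type _ := {a : E // IsOneDim a}

/-- A context: a finite set of one-dimensional sharp effects with orthogonal sum `1`. -/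
structure Context (E : Type*) [ConvexEffectAlgebra E] where
  elems : Finset (S1 E)
  sum_eq_one : HasOrthoSum (fun a : S1 E => a.1) elems 1

/-- `b = ⊕ᵢ tᵢ aᵢ`, where the `aᵢ` are the elements of the context `A`. -/
def IsDecomp {E : Type*} [ConvexEffectAlgebra E] (A : Context E) (t : A.elems → I) (b : E) :
    Prop :=
  HasOrthoSum (fun a : A.elems => t a • a.1.1) Finset.univ b

/-- `E` is spectral. -/
def IsSpectral (E : Type*) [ConvexEffectAlgebra E] : Prop :=
  ∀ b : E, ∃ (A : Context E) (t : A.elems → I), IsDecomp A t b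

/-- The state space `H(A)` of a context: the complex Hilbert space with orthonormal basis
`â`, `a ∈ A`. -/
abbrev StateSpace {E : Type*} [ConvexEffectAlgebra E] (A : Context E) : Type _ :=
  EuclideanSpace ℂ A.elems

open Classical in
/-- The basis vector `â` of `H(A)`. -/
noncomputable def ket {E : Type*} [ConvexEffectAlgebra E] (A : Context E) (a : A.elems) :
    StateSpace A :=
  EuclideanSpace.single a 1

/-- The set of all contexts is comparable, through the unitaries `U A B : H(A) → H(B)`; the state
assigned to the one-dimensional effect `a` is `hat a`. -/
def IsComparable {E : Type*} [ConvexEffectAlgebra E] (hat : S1 E → State E)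
    (U : ∀ A B : Context E, StateSpace A ≃ₗᵢ[ℂ] StateSpace B) : Prop :=
  (∀ A, U A A = LinearIsometryEquiv.refl ℂ (StateSpace A)) ∧
  (∀ A B, U A B = (U B A).symm) ∧
  ∀ (A B C : Context E) (a : A.elems) (c : C.elems),
    ‖inner ℂ (U A B (ket A a)) (U C B (ket C c))‖ ^ 2 = ((hat a.1).toFun c.1.1 : ℝ)

/-- The set of all contexts is complete, through the unitaries `U A B`: it is comparable, and every
unit vector `φ` of every `H(B)` is, up to a phase (so, as a pure state), of the form
`U A B â` for some context `A` and some `a ∈ A`. -/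
def IsComplete {E : Type*} [ConvexEffectAlgebra E] (hat : S1 E → State E)
    (U : ∀ A B : Context E, StateSpace A ≃ₗᵢ[ℂ] StateSpace B) : Prop :=
  IsComparable hat U ∧
  ∀ (B : Context E) (φ : StateSpace B), ‖φ‖ = 1 →
    ∃ (A : Context E) (a : A.elems) (z : ℂ), ‖z‖ = 1 ∧ U A B (ket A a) = z • φ

/-- The operator `∑ᵢ tᵢ P(U_{AB} âᵢ)` on `H(B)`, where `P(v)` is the orthogonal projection onto the
line spanned by `v`. -/
noncomputable def decompOp {E : Type*} [ConvexEffectAlgebra E]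
    (U : ∀ A B : Context E, StateSpace A ≃ₗᵢ[ℂ] StateSpace B) (B A : Context E)
    (t : A.elems → I) : StateSpace B →L[ℂ] StateSpace B :=
  ∑ a : A.elems, ((t a : ℝ) : ℂ) •
    (Submodule.span ℂ {U A B (ket A a)}).starProjection

/-- The representation `J : E → E(H(B))` of a spectral convex effect algebra with a complete set of
contexts: `J b = ∑ᵢ tᵢ P(U_{AB} âᵢ)`, where `b = ⊕ᵢ tᵢ aᵢ` for a context `A = {aᵢ}`. (For a complete
set of contexts the operator does not depend on the decomposition of `b`.) -/
noncomputable def J {E : Type*} [ConvexEffectAlgebra E] (hs : IsSpectral E)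
    (U : ∀ A B : Context E, StateSpace A ≃ₗᵢ[ℂ] StateSpace B) (B : Context E) (b : E) :
    StateSpace B →L[ℂ] StateSpace B :=
  decompOp U B (hs b).choose (hs b).choose_spec.choose

end ConvexEffectAlgebra

namespace ConvexSEA

/-- `a | b`: the effects `a` and `b` do not interfere. -/
def NonInterfering {E : Type*} [ConvexSEA E] (a b : E) : Prop :=
  seq a b = seq b a

end ConvexSEA

/-! The operators `J b` are controlled by their quadratic forms: at the transported vector of `c` in
a context, the form of `J b` equals the value of the state `hat c` at `b`, because the transition
probabilities are the values of these states (`inner_J`). By completeness such vectors exhaust the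
rays, so identities between operators reduce to identities between states (`op_ext`). Spectrality
makes these states separate effects and detect orthogonality. Hence `J` is affine, injective,
reflects `Perp`, and attains every rank one projection at a sharp effect (`isFaithfulRep_J`); the
rest uses only these properties.

If the operators commute, they share an eigenbasis. Its projections lift to sharp, mutually
orthogonal effects, with products zero off the diagonal and idempotent on it. Expanding both effects
in them gives non-interference and the product formula (`seq_of_diagOp`).

Conversely, let `a` and `b` not interfere. The effects not interfering with `b` are closed under
complements, scalars, mixtures and sequential products. Within one eigenbasis of `a` this closure
yields enough polynomials to reach the spectral projections of `a` (`Good.indicator`). A projection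
not interfering with `b` splits `b` into two blocks, hence commutes with it, and so does `a`. -/

namespace EffectAlgebra

/-! ### Cancellation, complements and order in effect algebras. -/

section Basic

variable {E : Type*} [EffectAlgebra E]

theorem Perp.symm {a b : E} (h : Perp a b) : Perp b a := perp_symm a b h

theorem compl_one : compl (1 : E) = 0 :=
  eq_zero_of_perp_one _ (perp_compl 1).symm

theorem perp_one_zero : Perp (1 : E) 0 := compl_one (E := E) ▸ perp_compl (1 : E)

theorem one_oplus_zero : oplus (1 : E) 0 = 1 := by
  have h := oplus_compl (1 : E)
  rwa [compl_one] at h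

theorem compl_oplus (a : E) : oplus (compl a) a = 1 := by
  rw [oplus_comm a _ (perp_compl a), oplus_compl]

theorem compl_compl (a : E) : compl (compl a) = a :=
  (compl_unique _ _ (perp_compl a).symm (compl_oplus a)).symm

theorem perp_zero (a : E) : Perp a 0 := by
  refine perp_of_oplus_perp (compl a) a 0 (perp_compl a).symm ?_
  rw [compl_oplus]; exact perp_one_zero

theorem oplus_zero (a : E) : oplus a 0 = a := by
  have h1 : Perp (oplus (compl a) a) 0 := perp_zero _
  have h2 := perp_oplus_of_oplus_perp _ _ _ (perp_compl a).symm h1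
  have h3 := oplus_assoc _ _ _ (perp_compl a).symm h1
  rw [compl_oplus, one_oplus_zero] at h3
  rw [compl_unique _ _ h2 h3, compl_compl]

theorem compl_zero : compl (0 : E) = 1 := by
  rw [← compl_one, compl_compl]

theorem oplus_right_cancel {a b c : E} (ha : Perp a c) (hb : Perp b c)
    (h : oplus a c = oplus b c) : a = b := by
  set d := compl (oplus a c) with hd
  -- Uniqueness of complements forces cancellation: both candidates are the complement of the same
  -- element.
  have key : ∀ x : E, Perp x c → oplus x c = oplus a c → x = compl (oplus c d) := by
    intro x hx hxc
    have h1 : Perp (oplus x c) d := by rw [hxc, hd]; exact perp_compl _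
    have h2 := perp_oplus_of_oplus_perp _ _ _ hx h1
    have h3 := oplus_assoc _ _ _ hx h1
    rw [hxc, hd, oplus_compl, ← hd] at h3
    exact compl_unique _ _ h2.symm (by rw [oplus_comm _ _ h2, h3])
  rw [key a ha rfl, ← key b hb h.symm]

theorem oplus_left_cancel {a b c : E} (ha : Perp c a) (hb : Perp c b)
    (h : oplus c a = oplus c b) : a = b :=
  oplus_right_cancel ha.symm hb.symm (by rw [oplus_comm _ _ ha, oplus_comm _ _ hb, h])

theorem right_eq_zero_of_oplus_eq_zero {a b : E} (hab : Perp a b) (h : oplus a b = 0) : b = 0 :=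
  eq_zero_of_perp_one _ (perp_of_oplus_perp a b 1 hab (by rw [h]; exact (perp_zero 1).symm))

theorem left_eq_zero_of_oplus_eq_zero {a b : E} (hab : Perp a b) (h : oplus a b = 0) : a = 0 := by
  rwa [right_eq_zero_of_oplus_eq_zero hab h, oplus_zero] at h

theorem Le.refl (a : E) : Le a a := ⟨0, perp_zero a, oplus_zero a⟩

theorem Le.eq_zero {a : E} (h : Le a 0) : a = 0 := by
  obtain ⟨c, hc, h⟩ := h
  exact left_eq_zero_of_oplus_eq_zero hc h

theorem Le.perp_left {a b d : E} (h : Le a b) (hbd : Perp b d) :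
    Perp a d ∧ Le (oplus a d) (oplus b d) := by
  obtain ⟨c, hc, rfl⟩ := h
  have h1 : Perp c a := hc.symm
  have h0 : Perp (oplus c a) d := by rwa [oplus_comm _ _ hc]
  have h2 := perp_of_oplus_perp _ _ _ h1 h0
  have h3 := perp_oplus_of_oplus_perp _ _ _ h1 h0
  refine ⟨h2, c, h3.symm, ?_⟩
  rw [oplus_comm _ _ h3, oplus_assoc _ _ _ h1 h0, oplus_comm _ _ hc]

theorem Le.trans {a b c : E} (h : Le a b) (h' : Le b c) : Le a c := by
  obtain ⟨x, hx, rfl⟩ := h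
  obtain ⟨y, hy, rfl⟩ := h'
  exact ⟨_, perp_oplus_of_oplus_perp _ _ _ hx hy, oplus_assoc _ _ _ hx hy⟩

theorem Le.perp {a b c d : E} (h : Le a b) (h' : Le c d) (hbd : Perp b d) :
    Perp a c ∧ Le (oplus a c) (oplus b d) := by
  obtain ⟨h1, h2⟩ := h.perp_left hbd
  obtain ⟨h3, h4⟩ := h'.perp_left h1.symm
  refine ⟨h3.symm, Le.trans ?_ h2⟩
  rwa [oplus_comm _ _ h3, oplus_comm _ _ h1.symm] at *

theorem Perp.le_compl {a b : E} (h : Perp a b) : Le a (compl b) := by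
  refine ⟨compl (oplus a b), ?_, ?_⟩
  all_goals
    have h0 : Perp (oplus b a) (compl (oplus a b)) := by
      rw [oplus_comm _ _ h]; exact perp_compl _
    have h1 := perp_of_oplus_perp _ _ _ h.symm h0
  · exact h1
  · have h2 := perp_oplus_of_oplus_perp _ _ _ h.symm h0
    have h3 := oplus_assoc _ _ _ h.symm h0
    rw [oplus_comm _ _ h, oplus_compl] at h3
    exact compl_unique _ _ h2 h3

theorem Le.perp_of_compl {a b : E} (h : Le a (compl b)) : Perp a b :=
  (h.perp_left (perp_compl b).symm).1

end Basic

/-! ### Finite orthogonal sums. -/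

section OrthoSum

variable {E : Type*} [EffectAlgebra E] {ι κ : Type*}

/-- Any term can be moved to the outermost position, so the order of summation does not matter. -/
theorem HasOrthoSum.exists_erase [DecidableEq ι] {f : ι → E} {s : Finset ι} {x : E}
    (h : HasOrthoSum f s x) {i : ι} (hi : i ∈ s) :
    ∃ y, HasOrthoSum f (s.erase i) y ∧ Perp (f i) y ∧ x = oplus (f i) y := by
  induction h with
  | empty => simp at hi
  | cons j s hj x h hp ih =>
    by_cases hij : i = j
    · subst hij
      exact ⟨x, by rwa [Finset.cons_eq_insert, Finset.erase_insert hj], hp, rfl⟩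
    · have his : i ∈ s := by simpa [hij] using hi
      obtain ⟨y, hy, hiy, rfl⟩ := ih his
      have h1 := perp_of_oplus_perp _ _ _ hiy hp.symm
      have h2 := perp_oplus_of_oplus_perp _ _ _ hiy hp.symm
      have h3 := oplus_assoc _ _ _ hiy hp.symm
      have hj' : j ∉ s.erase i := fun h => hj (Finset.mem_of_mem_erase h)
      refine ⟨oplus (f j) y, ?_, ?_, ?_⟩
      · have : (Finset.cons j s hj).erase i = Finset.cons j (s.erase i) hj' := by
          ext k; simp only [Finset.mem_erase, Finset.mem_cons]; grind
        rw [this]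
        exact HasOrthoSum.cons _ _ _ _ hy h1.symm
      · rwa [oplus_comm _ _ h1]
      · rw [oplus_comm _ _ h1, h3, oplus_comm _ _ hp]

theorem HasOrthoSum.eq_zero_of_empty {f : ι → E} {x : E} (h : HasOrthoSum f ∅ x) : x = 0 := by
  generalize hs : (∅ : Finset ι) = s at h
  cases h with
  | empty => rfl
  | cons i s hi => exact absurd hs.symm (by simp)

theorem HasOrthoSum.unique {f : ι → E} {s : Finset ι} {x y : E}
    (hx : HasOrthoSum f s x) (hy : HasOrthoSum f s y) : x = y := by
  classical
  induction hx generalizing y with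
  | empty => exact hy.eq_zero_of_empty.symm
  | cons i s hi x _ _ ih =>
    obtain ⟨z, hz, -, rfl⟩ := hy.exists_erase (Finset.mem_cons_self i s)
    rw [Finset.cons_eq_insert, Finset.erase_insert hi] at hz
    rw [ih hz]

theorem HasOrthoSum.mono {f g : ι → E} {s : Finset ι} {x : E} (h : HasOrthoSum f s x)
    (hgf : ∀ i, Le (g i) (f i)) : ∃ y, HasOrthoSum g s y ∧ Le y x := by
  induction h with
  | empty => exact ⟨0, .empty, Le.refl 0⟩
  | cons i s hi x _ hp ih =>
    obtain ⟨y, hy, hyx⟩ := ih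
    obtain ⟨h1, h2⟩ := (hgf i).perp hyx hp
    exact ⟨_, .cons i s hi y hy h1, h2⟩

theorem HasOrthoSum.of_map (e : κ ↪ ι) {f : ι → E} {s : Finset ι} {x : E}
    (h : HasOrthoSum f s x) {t : Finset κ} (ht : t.map e = s) :
    HasOrthoSum (fun k => f (e k)) t x := by
  classical
  induction h generalizing t with
  | empty => rw [Finset.map_eq_empty] at ht; subst ht; exact .empty
  | cons i s hi x _ hp ih =>
    have hmem : i ∈ t.map e := by rw [ht]; exact Finset.mem_cons_self i s
    obtain ⟨k, hk, rfl⟩ := Finset.mem_map.1 hmem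
    have h1 : (t.erase k).map e = s := by
      rw [Finset.map_erase, ht, Finset.cons_eq_insert, Finset.erase_insert hi]
    have h2 : t = Finset.cons k (t.erase k) (Finset.notMem_erase k t) := by
      rw [Finset.cons_eq_insert, Finset.insert_erase hk]
    rw [h2]
    exact HasOrthoSum.cons (f := fun k => f (e k)) _ _ _ _ (ih h1) hp

end OrthoSum

/-! ### States, and additive functions on the unit interval. -/

section State

variable {E : Type*} [EffectAlgebra E]

/-- The value of a state as a real number. -/
def State.val (ω : State E) (a : E) : ℝ := ω.toFun a

variable (ω : State E)

theorem State.val_nonneg (a : E) : 0 ≤ ω.val a := (ω.toFun a).2.1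

theorem State.val_le_one (a : E) : ω.val a ≤ 1 := (ω.toFun a).2.2

theorem State.val_oplus {a b : E} (h : Perp a b) : ω.val (oplus a b) = ω.val a + ω.val b :=
  ω.map_oplus a b h

theorem State.val_one : ω.val 1 = 1 := by simp [State.val, ω.map_one]

theorem State.val_zero : ω.val 0 = 0 := by
  have h := ω.val_oplus (perp_zero (0 : E))
  rw [oplus_zero] at h
  linarith

theorem State.val_compl (a : E) : ω.val (compl a) = 1 - ω.val a := by
  have h := ω.val_oplus (perp_compl a)
  rw [oplus_compl, ω.val_one] at h
  linarith

theorem State.val_orthoSum {ι : Type*} {f : ι → E} {s : Finset ι} {x : E}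
    (h : HasOrthoSum f s x) : ω.val x = ∑ i ∈ s, ω.val (f i) := by
  induction h with
  | empty => simpa using ω.val_zero
  | cons i s hi x _ hp ih => rw [Finset.sum_cons, ω.val_oplus hp, ih]

end State

end EffectAlgebra

/-- A bounded additive function on the unit interval that vanishes at `1` is zero. -/
theorem unitInterval.additive_eq_zero (g : I → ℝ) (M : ℝ) (hM : ∀ r, |g r| ≤ M) (h1 : g 1 = 0)
    (hadd : ∀ r s t : I, (r : ℝ) + s = t → g t = g r + g s) (r : I) : g r = 0 := by
  -- Doubling modulo 1: take `2 * r` when it stays in the interval, otherwise `2 * r - 1`, which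
  -- works because `g 1 = 0`. Iterating contradicts boundedness unless `g r = 0`.
  have double : ∀ r : I, ∃ r' : I, g r' = 2 * g r := by
    intro r
    rcases le_total (r : ℝ) (1 / 2) with h | h
    · have := r.2.1
      refine ⟨⟨2 * r, by constructor <;> linarith⟩, ?_⟩
      rw [hadd r r _ (by simp only; ring)]; ring
    · have := r.2.2
      have e1 := hadd r (σ r) 1 (by simp)
      have e2 := hadd (σ r) (σ r) ⟨2 - 2 * r, by constructor <;> linarith⟩
        (by simp only [unitInterval.coe_symm_eq]; ring)
      have e3 := hadd ⟨2 - 2 * r, by constructor <;> linarith⟩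
        ⟨2 * r - 1, by constructor <;> linarith⟩ 1 (by simp only [Set.Icc.coe_one]; ring)
      exact ⟨⟨2 * r - 1, by constructor <;> linarith⟩, by linarith⟩
  have pow : ∀ n : ℕ, ∃ r' : I, g r' = 2 ^ n * g r := by
    intro n
    induction n with
    | zero => exact ⟨r, by simp⟩
    | succ n ih =>
      obtain ⟨r', h⟩ := ih
      obtain ⟨r'', h'⟩ := double r'
      exact ⟨r'', by rw [h', h]; ring⟩
  by_contra hne
  have hpos : 0 < |g r| := abs_pos.2 hne
  obtain ⟨n, hn⟩ := pow_unbounded_of_one_lt (M / |g r|) (one_lt_two)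
  obtain ⟨r', h'⟩ := pow n
  have := hM r'
  rw [h', abs_mul, abs_of_pos (by positivity : (0 : ℝ) < 2 ^ n)] at this
  rw [div_lt_iff₀ hpos] at hn
  linarith

/-! ### Scalars and states in convex effect algebras. -/

namespace ConvexEffectAlgebra

open EffectAlgebra

variable {E : Type*} [ConvexEffectAlgebra E]

theorem zero_smul' (a : E) : (0 : I) • a = 0 := by
  have h1 := add_smul_perp 0 0 0 a (by simp)
  have h2 := add_smul 0 0 0 a (by simp)
  exact oplus_left_cancel h1 (perp_zero _) (by rw [← h2, oplus_zero])

theorem smul_zero' (r : I) : r • (0 : E) = 0 := by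
  rw [← zero_smul' (0 : E), smul_smul, mul_zero]

theorem smul_le_smul_one (r : I) (a : E) : Le (r • a) (r • (1 : E)) :=
  ⟨r • compl a, smul_perp _ _ _ (perp_compl a), by
    rw [← smul_oplus _ _ _ (perp_compl a), oplus_compl]⟩

theorem smul_le (r : I) (a : E) : Le (r • a) a :=
  ⟨σ r • a, add_smul_perp _ _ 1 a (by simp), by
    rw [← add_smul r (σ r) 1 a (by simp), one_smul]⟩

theorem smul_perp_smul (r s : I) (h : (r : ℝ) + s ≤ 1) (a b : E) : Perp (r • a) (s • b) := by
  have h1 : Perp (r • (1 : E)) (s • (1 : E)) :=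
    add_smul_perp r s ⟨r + s, add_nonneg r.2.1 s.2.1, h⟩ 1 rfl
  exact ((smul_le_smul_one r a).perp (smul_le_smul_one s b) h1).1

/-- States are only assumed additive; homogeneity follows because the deviation from linearity in
`r` is additive, bounded and zero at `1`. -/
theorem _root_.EffectAlgebra.State.val_smul (ω : State E) (r : I) (a : E) :
    ω.val (r • a) = r * ω.val a := by
  have h := unitInterval.additive_eq_zero (fun r => ω.val (r • a) - r * ω.val a) 1 ?_ ?_ ?_ r
  · simpa [sub_eq_zero] using h
  · intro r
    have h1 := ω.val_nonneg (r • a)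
    have h2 := ω.val_le_one (r • a)
    have h3 := mul_nonneg r.2.1 (ω.val_nonneg a)
    have h4 := mul_le_one₀ r.2.2 (ω.val_nonneg a) (ω.val_le_one a)
    simp only [abs_le]
    constructor <;> linarith
  · simp [one_smul]
  · intro r s t hrs
    rw [add_smul r s t a hrs, ω.val_oplus (add_smul_perp r s t a hrs), ← hrs]
    ring

theorem _root_.EffectAlgebra.HasOrthoSum.smul {ι : Type*} {f : ι → E} {s : Finset ι} {x : E}
    (h : HasOrthoSum f s x) (r : I) : HasOrthoSum (fun i => r • f i) s (r • x) := by
  induction h with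
  | empty => rw [smul_zero']; exact .empty
  | cons i s hi x _ hp ih =>
    rw [smul_oplus _ _ _ hp]
    exact HasOrthoSum.cons (f := fun i => r • f i) i s hi _ ih (smul_perp _ _ _ hp)

theorem Context.hasOrthoSum_univ (C : Context E) :
    HasOrthoSum (fun c : C.elems => c.1.1) Finset.univ 1 :=
  C.sum_eq_one.of_map (Function.Embedding.subtype _) Finset.attach_map_val

/-- The number `1 / 2` of the unit interval. -/
noncomputable def half : I := ⟨1 / 2, by norm_num, by norm_num⟩

theorem coe_half : (half : ℝ) = 1 / 2 := rfl

theorem half_perp (a b : E) : Perp (half • a) (half • b) :=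
  smul_perp_smul _ _ (by norm_num [coe_half]) _ _

theorem half_oplus_half (a : E) : oplus (half • a) (half • a) = a := by
  rw [← add_smul half half 1 a (by norm_num [coe_half]), one_smul]

/-- If `(x ⊕ y) / 2` is half of an effect, then `x ⊕ y` is defined. -/
theorem perp_of_half_eq {x y w : E} (h : oplus (half • x) (half • y) = half • w) : Perp x y := by
  have h0 := half_perp x y
  have h1 : Perp (oplus (half • x) (half • y)) (half • compl w) := by rw [h]; exact half_perp _ _
  have h2 := perp_of_oplus_perp _ _ _ h0 h1
  have h3 := perp_oplus_of_oplus_perp _ _ _ h0 h1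
  have h4 := oplus_assoc _ _ _ h0 h1
  -- Write half of the unit both as `w/2 ⊕ w'/2` and as `x/2 ⊕ x'/2`; cancelling `x/2` leaves `y/2 ≤
  -- x'/2`, which is then doubled.
  rw [h, ← smul_oplus _ _ _ (perp_compl w), oplus_compl, ← oplus_compl x,
    smul_oplus _ _ _ (perp_compl x)] at h4
  have h5 := oplus_left_cancel h3 (half_perp _ _) h4
  have hle : Le (half • y) (half • compl x) := ⟨_, h2, h5⟩
  have h6 := (hle.perp hle (half_perp _ _)).2
  rw [half_oplus_half, half_oplus_half] at h6
  exact h6.perp_of_compl.symm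

/-! ### The states of one-dimensional effects determine order and equality. -/

section Separation

variable {hat : S1 E → State E}

/-- The state of `c` already spends its total mass 1 on `c`, so it vanishes on the rest of the
context and reads off one coefficient. -/
theorem hat_val_of_isDecomp (hat_self : ∀ a : S1 E, (hat a).toFun a.1 = 1) {C : Context E}
    {t : C.elems → I} {z : E} (h : IsDecomp C t z) (c : C.elems) :
    (hat c.1).val z = t c := by
  classical
  have self : (hat c.1).val c.1.1 = 1 := by simp [State.val, hat_self]
  have h1 := (hat c.1).val_orthoSum C.hasOrthoSum_univ
  rw [State.val_one, ← Finset.add_sum_erase _ _ (Finset.mem_univ c), self] at h1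
  have h0 : ∑ d ∈ Finset.univ.erase c, (hat c.1).val d.1.1 = 0 := by linarith
  rw [Finset.sum_eq_zero_iff_of_nonneg (fun _ _ => State.val_nonneg _ _)] at h0
  rw [(hat c.1).val_orthoSum h, ← Finset.add_sum_erase _ _ (Finset.mem_univ c),
    Finset.sum_eq_zero, State.val_smul, self]
  · simp
  · intro d hd
    rw [State.val_smul, h0 d hd, mul_zero]

/-- The midpoint of `x` and `y` always exists. The bound makes its spectral coefficients at most
1/2, so they can be doubled, exhibiting the midpoint as half of an effect. -/
theorem perp_of_hat_le (hs : IsSpectral E) (hat_self : ∀ a : S1 E, (hat a).toFun a.1 = 1)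
    {x y : E} (h : ∀ (C : Context E) (c : C.elems), (hat c.1).val x + (hat c.1).val y ≤ 1) :
    Perp x y := by
  obtain ⟨C, t, ht⟩ := hs (oplus (half • x) (half • y))
  have hle : ∀ c, (t c : ℝ) ≤ 1 / 2 := by
    intro c
    rw [← hat_val_of_isDecomp hat_self ht c, State.val_oplus _ (half_perp x y), State.val_smul,
      State.val_smul, coe_half]
    linarith [h C c]
  let u : C.elems → I := fun c => ⟨2 * t c, by have := (t c).2.1; linarith, by linarith [hle c]⟩
  obtain ⟨w, hw, -⟩ := C.hasOrthoSum_univ.mono (g := fun c => u c • c.1.1) (fun c => smul_le _ _)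
  have hw' := hw.smul half
  have heq : (fun c : C.elems => half • u c • c.1.1) = fun c => t c • c.1.1 := by
    funext c
    rw [smul_smul]
    congr 1
    ext
    simp [u, coe_half]
  rw [heq] at hw'
  exact perp_of_half_eq (ht.unique hw')

theorem eq_zero_of_hat_eq_zero (hs : IsSpectral E)
    (hat_self : ∀ a : S1 E, (hat a).toFun a.1 = 1) {x : E}
    (h : ∀ (C : Context E) (c : C.elems), (hat c.1).val x = 0) : x = 0 := by
  obtain ⟨C, t, ht⟩ := hs x
  have h0 : t = fun _ => 0 := by
    funext c
    ext
    rw [← hat_val_of_isDecomp hat_self ht c, h, Set.Icc.coe_zero]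
  have h1 := (C.hasOrthoSum_univ).smul 0
  rw [zero_smul'] at h1
  subst h0
  exact ht.unique h1

theorem eq_of_hat_eq (hs : IsSpectral E) (hat_self : ∀ a : S1 E, (hat a).toFun a.1 = 1) {x y : E}
    (h : ∀ (C : Context E) (c : C.elems), (hat c.1).val x = (hat c.1).val y) : x = y := by
  have hp : Perp x (compl y) := perp_of_hat_le hs hat_self fun C c => by
    rw [h, State.val_compl]; linarith
  have h0 : compl (oplus x (compl y)) = 0 := eq_zero_of_hat_eq_zero hs hat_self fun C c => by
    rw [State.val_compl, State.val_oplus _ hp, h, State.val_compl]; ring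
  have h1 : oplus x (compl y) = 1 := by rw [← compl_compl (oplus x (compl y)), h0, compl_zero]
  rw [← compl_compl y]
  exact compl_unique _ _ hp.symm (by rw [oplus_comm _ _ hp, h1])

end Separation

end ConvexEffectAlgebra

/-! ### Elementary properties of the sequential product. -/

namespace ConvexSEA

open EffectAlgebra ConvexEffectAlgebra

variable {E : Type*} [ConvexSEA E]

theorem seq_zero (a : E) : seq a 0 = 0 := by
  have h1 := seq_oplus a 0 0 (perp_zero 0)
  have h2 := seq_perp a 0 0 (perp_zero 0)
  rw [oplus_zero] at h1
  exact oplus_left_cancel h2 (perp_zero _) (by rw [← h1, oplus_zero])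

theorem NonInterfering.symm {a b : E} (h : NonInterfering a b) : NonInterfering b a := Eq.symm h

theorem nonInterfering_one (a : E) : NonInterfering a 1 := by
  have h := comm_compl a 0 (comm_of_seq_eq_zero a 0 (seq_zero a))
  rwa [compl_zero] at h

theorem NonInterfering.compl {a b : E} (h : NonInterfering a b) : NonInterfering a (compl b) :=
  comm_compl a b h

theorem NonInterfering.oplus {a b c : E} (ha : NonInterfering c a) (hb : NonInterfering c b)
    (h : Perp a b) : NonInterfering c (oplus a b) := comm_oplus a b c ha hb h

theorem NonInterfering.seq {a b c : E} (ha : NonInterfering c a) (hb : NonInterfering c b) :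
    NonInterfering c (seq a b) := comm_seq a b c ha hb

theorem NonInterfering.smul {a b : E} (h : NonInterfering a b) (r : I) :
    NonInterfering a (r • b) := by
  unfold NonInterfering at *
  rw [seq_smul, smul_seq, h]

theorem seq_one (a : E) : seq a 1 = a := by
  rw [nonInterfering_one a, one_seq]

theorem seq_oplus_seq_compl (a b : E) : oplus (seq a b) (seq a (compl b)) = a := by
  rw [← seq_oplus _ _ _ (perp_compl b), oplus_compl, seq_one]

theorem seq_perp_seq_compl (a b : E) : Perp (seq a b) (seq a (compl b)) :=
  seq_perp _ _ _ (perp_compl b)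

theorem seq_le (a b : E) : Le (seq a b) a :=
  ⟨_, seq_perp_seq_compl a b, seq_oplus_seq_compl a b⟩

/-- Since `a` does not interfere with its complement, their product lies below both. -/
theorem _root_.EffectAlgebra.IsSharp.seq_compl {a : E} (h : IsSharp a) :
    seq a (compl a) = 0 := by
  refine (h _ (seq_le _ _) ?_).eq_zero
  rw [comm_compl a a rfl]
  exact seq_le _ _

theorem _root_.EffectAlgebra.IsSharp.seq_self {a : E} (h : IsSharp a) : seq a a = a := by
  have h1 := seq_oplus_seq_compl a a
  rwa [h.seq_compl, oplus_zero] at h1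

theorem _root_.EffectAlgebra.IsSharp.seq_eq_zero {a b : E} (h : IsSharp a) (hab : Perp a b) :
    seq a b = 0 := by
  obtain ⟨c, hc, hbc⟩ := hab.symm.le_compl
  have h1 := h.seq_compl
  rw [← hbc, seq_oplus _ _ _ hc] at h1
  exact left_eq_zero_of_oplus_eq_zero (seq_perp _ _ _ hc) h1

end ConvexSEA

open scoped InnerProductSpace

universe u

/-! ### Operators diagonal in an orthonormal basis. -/

section Diagonal

variable {H : Type*} [NormedAddCommGroup H] [InnerProductSpace ℂ H]
  {ι : Type*} [Fintype ι]

/-- The orthogonal projection onto the line spanned by a vector. -/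
noncomputable def lineProj (v : H) : H →L[ℂ] H := (Submodule.span ℂ {v}).starProjection

theorem lineProj_apply {v : H} (hv : ‖v‖ = 1) (w : H) : lineProj v w = ⟪v, w⟫_ℂ • v :=
  Submodule.starProjection_unit_singleton ℂ hv w

theorem inner_lineProj {v : H} (hv : ‖v‖ = 1) (w : H) :
    ⟪w, lineProj v w⟫_ℂ = ((‖⟪v, w⟫_ℂ‖ ^ 2 : ℝ) : ℂ) := by
  rw [lineProj_apply hv, inner_smul_right, ← inner_conj_symm w v, RCLike.mul_conj]
  simp

theorem lineProj_smul {z : ℂ} (hz : ‖z‖ = 1) (v : H) : lineProj (z • v) = lineProj v := by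
  have hz0 : z ≠ 0 := fun h => by simp [h] at hz
  simp only [lineProj, Submodule.span_singleton_smul_eq (IsUnit.mk0 z hz0)]

/-- The operator that is diagonal in the orthonormal basis `v`, with real eigenvalues `s`. -/
noncomputable def diagOp (v : OrthonormalBasis ι ℂ H) (s : ι → ℝ) : H →L[ℂ] H :=
  ∑ i, (s i : ℂ) • lineProj (v i)

variable (v : OrthonormalBasis ι ℂ H)

theorem lineProj_basis [DecidableEq ι] (i j : ι) :
    lineProj (v i) (v j) = if i = j then v j else 0 := by
  rw [lineProj_apply (v.norm_eq_one i), orthonormal_iff_ite.1 v.orthonormal]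
  split_ifs with h
  · rw [one_smul, h]
  · rw [zero_smul]

theorem diagOp_basis (s : ι → ℝ) (j : ι) : diagOp v s (v j) = (s j : ℂ) • v j := by
  classical
  simp [diagOp, lineProj_basis]

theorem eq_diagOp_iff (T : H →L[ℂ] H) (s : ι → ℝ) :
    T = diagOp v s ↔ ∀ j, T (v j) = (s j : ℂ) • v j := by
  refine ⟨fun h j => by rw [h, diagOp_basis], fun h => ?_⟩
  refine ContinuousLinearMap.coe_injective (v.toBasis.ext fun j => ?_)
  simp [h, diagOp_basis]

theorem diagOp_mul (s t : ι → ℝ) : diagOp v s * diagOp v t = diagOp v (s * t) := by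
  rw [eq_diagOp_iff]
  intro j
  simp [diagOp_basis, _root_.smul_smul, mul_comm, -Complex.coe_smul]

theorem diagOp_add (s t : ι → ℝ) : diagOp v (s + t) = diagOp v s + diagOp v t := by
  symm
  rw [eq_diagOp_iff]
  intro j
  simp [diagOp_basis, add_smul]

theorem diagOp_smul (c : ℝ) (s : ι → ℝ) : diagOp v (c • s) = (c : ℂ) • diagOp v s := by
  symm
  rw [eq_diagOp_iff]
  intro j
  rw [smul_apply, diagOp_basis, _root_.smul_smul, Pi.smul_apply, smul_eq_mul, Complex.ofReal_mul]

theorem diagOp_one : diagOp v 1 = 1 := by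
  symm
  rw [eq_diagOp_iff]
  intro j
  simp

theorem inner_diagOp (s : ι → ℝ) (w : H) :
    ⟪w, diagOp v s w⟫_ℂ = ((∑ i, s i * ‖⟪v i, w⟫_ℂ‖ ^ 2 : ℝ) : ℂ) := by
  simp [diagOp, inner_lineProj (v.norm_eq_one _)]

theorem diagOp_isSymmetric (s : ι → ℝ) : (diagOp v s : H →ₗ[ℂ] H).IsSymmetric := by
  rw [LinearMap.isSymmetric_iff_inner_map_self_real]
  intro w
  rw [inner_conj_symm, ContinuousLinearMap.coe_coe, inner_diagOp, ← inner_conj_symm, inner_diagOp,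
    Complex.conj_ofReal]

theorem diagOp_apply_eq_zero {s : ι → ℝ} (hs : ∀ i, 0 ≤ s i) {w : H}
    (h : (⟪w, diagOp v s w⟫_ℂ).re ≤ 0) : diagOp v s w = 0 := by
  rw [inner_diagOp, Complex.ofReal_re] at h
  have h0 : ∀ i ∈ Finset.univ, 0 ≤ s i * ‖⟪v i, w⟫_ℂ‖ ^ 2 :=
    fun i _ => mul_nonneg (hs i) (sq_nonneg _)
  have h1 := (Finset.sum_eq_zero_iff_of_nonneg h0).1 (le_antisymm h (Finset.sum_nonneg h0))
  unfold diagOp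
  rw [sum_apply]
  refine Finset.sum_eq_zero fun i hi => ?_
  rw [smul_apply, lineProj_apply (v.norm_eq_one i)]
  rcases mul_eq_zero.1 (h1 i hi) with h2 | h2
  · rw [h2]; simp
  · rw [sq_eq_zero_iff, norm_eq_zero] at h2
    rw [h2]; simp

/-- Two commuting self-adjoint operators are diagonal in a common orthonormal basis. -/
theorem exists_common_eigenbasis [FiniteDimensional ℂ H] {S T : H →L[ℂ] H}
    (hS : (S : H →ₗ[ℂ] H).IsSymmetric) (hT : (T : H →ₗ[ℂ] H).IsSymmetric) (h : S * T = T * S) :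
    ∃ (κ : Type) (_ : Fintype κ) (v : OrthonormalBasis κ ℂ H) (s t : κ → ℝ),
      S = diagOp v s ∧ T = diagOp v t := by
  classical
  -- Commutation makes `T` preserve each eigenspace of `S`; diagonalizing the restrictions and
  -- collecting the bases gives the common one.
  have hinv : ∀ μ : Module.End.Eigenvalues (S : H →ₗ[ℂ] H),
      ∀ x ∈ Module.End.eigenspace (S : H →ₗ[ℂ] H) μ,
        (T : H →ₗ[ℂ] H) x ∈ Module.End.eigenspace (S : H →ₗ[ℂ] H) μ := by
    intro μ x hx
    rw [Module.End.mem_eigenspace_iff] at hx ⊢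
    have := congrArg (fun A : H →L[ℂ] H => A x) h
    simp only [mul_apply_eq_comp, ContinuousLinearMap.coe_coe] at this hx ⊢
    rw [this, hx, map_smul]
  let w := hS.direct_sum_isInternal.collectedOrthonormalBasis hS.orthogonalFamily_eigenspaces'
    fun μ => (hT.restrict_invariant (hinv μ)).eigenvectorBasis rfl
  have hwS : ∀ k, ∃ r : ℂ, S (w k) = r • w k := fun k =>
    ⟨_, Module.End.mem_eigenspace_iff.1
      (hS.direct_sum_isInternal.collectedOrthonormalBasis_mem hS.orthogonalFamily_eigenspaces' _ k)⟩
  have hwT : ∀ k, ∃ r : ℂ, T (w k) = r • w k := by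
    intro k
    have := (hT.restrict_invariant (hinv k.1)).apply_eigenvectorBasis rfl k.2
    refine ⟨((hT.restrict_invariant (hinv k.1)).eigenvalues rfl k.2 : ℝ), ?_⟩
    have h2 := congrArg Subtype.val this
    have hw : w k = (hT.restrict_invariant (hinv k.1)).eigenvectorBasis rfl k.2 := by
      simp [w, DirectSum.IsInternal.collectedOrthonormalBasis]
    rw [hw]
    exact h2
  have real : ∀ A : H →L[ℂ] H, (A : H →ₗ[ℂ] H).IsSymmetric → (∀ k, ∃ r : ℂ, A (w k) = r • w k) →
      ∀ k, ∃ r : ℝ, A (w k) = (r : ℂ) • w k := by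
    intro A hA hw k
    obtain ⟨r, hr⟩ := hw k
    refine ⟨r.re, ?_⟩
    have := hA (w k) (w k)
    simp only [ContinuousLinearMap.coe_coe, hr, inner_smul_left, inner_smul_right,
      inner_self_eq_norm_sq_to_K, w.norm_eq_one] at this
    rw [hr, Complex.conj_eq_iff_re.1 (by simpa using this)]
  choose s hs using real S hS hwS
  choose t ht using real T hT hwT
  let e := Fintype.equivFin (Σ μ : Module.End.Eigenvalues (S : H →ₗ[ℂ] H),
    Fin (Module.finrank ℂ (Module.End.eigenspace (S : H →ₗ[ℂ] H) μ)))
  refine ⟨_, inferInstance, w.reindex e, s ∘ e.symm, t ∘ e.symm, ?_, ?_⟩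
  · rw [eq_diagOp_iff]; intro j; simp [hs]
  · rw [eq_diagOp_iff]; intro j; simp [ht]

end Diagonal

/-! ### The representation `J` and its quadratic form. -/

open EffectAlgebra ConvexEffectAlgebra

/-- An order embedding of a convex effect algebra into the effects of a Hilbert space whose values
are diagonalizable and whose range contains all rank one projections. -/
structure IsFaithfulRep {E : Type u} [ConvexEffectAlgebra E] {H : Type*} [NormedAddCommGroup H]
    [InnerProductSpace ℂ H] (F : E → H →L[ℂ] H) : Prop where
  map_oplus : ∀ x y, Perp x y → F (oplus x y) = F x + F y
  map_smul : ∀ (r : I) x, F (r • x) = ((r : ℝ) : ℂ) • F x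
  map_one : F 1 = 1
  injective : Function.Injective F
  perp_of_le : ∀ x y, (∀ ψ : H, ‖ψ‖ = 1 → (⟪ψ, F x ψ⟫_ℂ).re + (⟪ψ, F y ψ⟫_ℂ).re ≤ 1) → Perp x y
  exists_diag : ∀ x, ∃ (ι : Type u) (_ : Fintype ι) (v : OrthonormalBasis ι ℂ H) (s : ι → I),
    F x = diagOp v fun i => s i
  exists_lineProj : ∀ ψ : H, ‖ψ‖ = 1 → ∃ e : E, IsSharp e ∧ F e = lineProj ψ

namespace ConvexEffectAlgebra

variable {E : Type u} [ConvexEffectAlgebra E] {hat : S1 E → State E}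
  {U : ∀ A B : Context E, StateSpace A ≃ₗᵢ[ℂ] StateSpace B}

/-- The orthonormal basis of `H(B)` given by a context `A`. -/
noncomputable def contextBasis (U : ∀ A B : Context E, StateSpace A ≃ₗᵢ[ℂ] StateSpace B)
    (B A : Context E) : OrthonormalBasis A.elems ℂ (StateSpace B) :=
  (EuclideanSpace.basisFun A.elems ℂ).map (U A B)

theorem contextBasis_apply (B A : Context E) (a : A.elems) :
    contextBasis U B A a = U A B (ket A a) := by
  classical
  simp only [contextBasis, OrthonormalBasis.map_apply, EuclideanSpace.basisFun_apply, ket]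

theorem decompOp_eq_diagOp (B A : Context E) (t : A.elems → I) :
    decompOp U B A t = diagOp (contextBasis U B A) fun a => t a := by
  simp only [decompOp, diagOp, contextBasis_apply, lineProj]

theorem inner_contextBasis (hU : IsComplete hat U) (B : Context E) {A C : Context E} (a : A.elems)
    (c : C.elems) : ‖⟪contextBasis U B A a, contextBasis U B C c⟫_ℂ‖ ^ 2 = (hat a.1).val c.1.1 := by
  rw [contextBasis_apply, contextBasis_apply]
  exact hU.1.2.2 A B C a c

theorem inner_decompOp (hU : IsComplete hat U) (B : Context E) {A : Context E} {t : A.elems → I}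
    {b : E} (h : IsDecomp A t b) {C : Context E} (c : C.elems) :
    ⟪contextBasis U B C c, decompOp U B A t (contextBasis U B C c)⟫_ℂ = ((hat c.1).val b : ℂ) := by
  rw [decompOp_eq_diagOp, inner_diagOp, State.val_orthoSum _ h]
  simp only [State.val_smul, ← inner_contextBasis hU B c, norm_inner_symm]

theorem inner_J (hs : IsSpectral E) (hU : IsComplete hat U) (B : Context E) (b : E) {C : Context E}
    (c : C.elems) :
    ⟪contextBasis U B C c, J hs U B b (contextBasis U B C c)⟫_ℂ = ((hat c.1).val b : ℂ) :=
  inner_decompOp hU B (hs b).choose_spec.choose_spec c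

theorem exists_eq_smul_contextBasis (hU : IsComplete hat U) {B : Context E} {ψ : StateSpace B}
    (hψ : ‖ψ‖ = 1) : ∃ (C : Context E) (c : C.elems) (z : ℂ), ‖z‖ = 1 ∧
      ψ = z • contextBasis U B C c := by
  obtain ⟨C, c, z, hz, h⟩ := hU.2 B ψ hψ
  have hz0 : z ≠ 0 := fun h => by simp [h] at hz
  refine ⟨C, c, z⁻¹, by simp [hz], ?_⟩
  rw [contextBasis_apply, h, _root_.smul_smul, inv_mul_cancel₀ hz0, _root_.one_smul]

/-- Every nonzero vector is a multiple of a context vector by completeness, and over ℂ the quadratic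
form determines the operator. -/
theorem op_ext (hU : IsComplete hat U) {B : Context E} {S T : StateSpace B →L[ℂ] StateSpace B}
    (h : ∀ (C : Context E) (c : C.elems), ⟪contextBasis U B C c, S (contextBasis U B C c)⟫_ℂ =
      ⟪contextBasis U B C c, T (contextBasis U B C c)⟫_ℂ) : S = T := by
  have key : ((S - T : StateSpace B →L[ℂ] StateSpace B) : StateSpace B →ₗ[ℂ] StateSpace B) = 0 := by
    rw [← inner_map_self_eq_zero]
    intro x
    rw [← inner_conj_symm, map_eq_zero]
    by_cases hx : x = 0
    · simp [hx]
    have hn : ‖x‖ ≠ 0 := norm_ne_zero_iff.2 hx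
    obtain ⟨C, c, z, -, hz⟩ := exists_eq_smul_contextBasis (hat := hat) hU (B := B)
      (ψ := ((‖x‖ : ℂ)⁻¹) • x) (by simp [norm_smul, hn])
    have hx' : x = ((‖x‖ : ℂ) * z) • contextBasis U B C c := by
      rw [← _root_.smul_smul, ← hz, _root_.smul_smul, mul_inv_cancel₀ (by exact_mod_cast hn), _root_.one_smul]
    rw [hx']
    simp only [ContinuousLinearMap.coe_coe, map_smul, inner_smul_left, inner_smul_right,
      sub_apply, inner_sub_right, h, sub_self, mul_zero]
  exact sub_eq_zero.1 (ContinuousLinearMap.coe_injective key)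

theorem isFaithfulRep_J (hs : IsSpectral E) (hat_self : ∀ a : S1 E, (hat a).toFun a.1 = 1)
    (hU : IsComplete hat U) (B : Context E) : IsFaithfulRep (J hs U B) where
  map_oplus x y h := op_ext hU fun C c => by
    simp [inner_J hs hU, State.val_oplus _ h]
  map_smul r x := op_ext hU fun C c => by
    simp [inner_J hs hU, State.val_smul]
  map_one := op_ext hU fun C c => by
    simp [inner_J hs hU, State.val_one, inner_self_eq_norm_sq_to_K]
  injective x y h := eq_of_hat_eq hs hat_self fun C c => by
    have h1 := inner_J hs hU B x c
    rw [h, inner_J hs hU B y c] at h1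
    exact_mod_cast h1.symm
  perp_of_le x y h := perp_of_hat_le hs hat_self fun C c => by
    simpa [inner_J hs hU] using h _ ((contextBasis U B C).norm_eq_one c)
  exists_diag x := ⟨_, inferInstance, contextBasis U B (hs x).choose, _, decompOp_eq_diagOp _ _ _⟩
  exists_lineProj ψ hψ := by
    obtain ⟨C, c, z, hz, rfl⟩ := exists_eq_smul_contextBasis hU hψ
    refine ⟨c.1.1, c.1.2.1, ?_⟩
    rw [lineProj_smul hz]
    refine op_ext hU fun D d => ?_
    rw [inner_J hs hU, inner_lineProj ((contextBasis U B C).norm_eq_one c), norm_inner_symm,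
      inner_contextBasis hU]

end ConvexEffectAlgebra

/-! ### From commuting operators to non-interfering effects. -/

open ConvexSEA

namespace IsFaithfulRep

variable {E : Type u} [ConvexSEA E] {H : Type*} [NormedAddCommGroup H] [InnerProductSpace ℂ H]
  {F : E → H →L[ℂ] H} {ι : Type*} [Fintype ι] {v : OrthonormalBasis ι ℂ H} {e : ι → E}

theorem map_zero (hF : IsFaithfulRep F) : F 0 = 0 := by
  rw [← zero_smul' (1 : E), hF.map_smul]
  simp

theorem map_compl (hF : IsFaithfulRep F) (x : E) : F (compl x) = 1 - F x := by
  rw [← hF.map_one, ← oplus_compl x, hF.map_oplus _ _ (perp_compl x), add_sub_cancel_left]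

theorem isSymmetric (hF : IsFaithfulRep F) (x : E) : (F x : H →ₗ[ℂ] H).IsSymmetric := by
  obtain ⟨κ, _, w, s, hs⟩ := hF.exists_diag x
  rw [hs]
  exact diagOp_isSymmetric w _

theorem inner_nonneg (hF : IsFaithfulRep F) (x : E) (ψ : H) : 0 ≤ (⟪ψ, F x ψ⟫_ℂ).re := by
  obtain ⟨κ, _, w, s, hs⟩ := hF.exists_diag x
  rw [hs, inner_diagOp, Complex.ofReal_re]
  exact Finset.sum_nonneg fun i _ => mul_nonneg (s i).2.1 (sq_nonneg _)

theorem apply_eq_zero (hF : IsFaithfulRep F) {x : E} {ψ : H} (h : (⟪ψ, F x ψ⟫_ℂ).re ≤ 0) :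
    F x ψ = 0 := by
  obtain ⟨κ, _, w, s, hs⟩ := hF.exists_diag x
  rw [hs] at h ⊢
  exact diagOp_apply_eq_zero w (fun i => (s i).2.1) h

theorem mul_eq_zero_comm (hF : IsFaithfulRep F) {x y : E} (h : F x * F y = 0) :
    F y * F x = 0 := by
  ext ψ
  refine ext_inner_left ℂ fun χ => ?_
  have h1 := hF.isSymmetric y χ (F x ψ)
  have h2 := hF.isSymmetric x (F y χ) ψ
  have h3 := congrArg (fun A : H →L[ℂ] H => A χ) h
  simp only [ContinuousLinearMap.coe_coe, mul_apply_eq_comp, zero_apply] at h1 h2 h3 ⊢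
  rw [← h1, ← h2, h3]
  simp

/-- On the range of `F q` the forms of `x` and of its remainder in `p` are nonnegative with sum
zero; a positive operator kills any vector where its form vanishes. -/
theorem mul_eq_zero_of_le (hF : IsFaithfulRep F) {x p q : E} (hx : Le x p) (hpq : F p * F q = 0) :
    F x * F q = 0 := by
  obtain ⟨y, hy, rfl⟩ := hx
  ext ψ
  have h0 : (⟪F q ψ, F (oplus x y) (F q ψ)⟫_ℂ).re = 0 := by
    have h3 := congrArg (fun A : H →L[ℂ] H => A ψ) hpq
    simp only [mul_apply_eq_comp, zero_apply] at h3
    rw [h3]; simp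
  rw [hF.map_oplus _ _ hy, add_apply, inner_add_right, Complex.add_re] at h0
  have h1 := hF.inner_nonneg y (F q ψ)
  simpa using hF.apply_eq_zero (x := x) (ψ := F q ψ) (by linarith)

/-- An effect that does not interfere with a projection commutes with it. -/
theorem commute_of_nonInterfering_proj (hF : IsFaithfulRep F) {p b : E} (hp : F p * F p = F p)
    (h : NonInterfering b p) : F p * F b = F b * F p := by
  have hp1 : F p * F (compl p) = 0 := by rw [hF.map_compl, mul_sub, mul_one, hp, sub_self]
  have hp2 : F (compl p) * F p = 0 := hF.mul_eq_zero_comm hp1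
  -- By non-interference `b` is the sum of `p ∘ b ≤ p` and `p' ∘ b ≤ p'`. Each summand is supported
  -- on its own block.
  have hb := seq_oplus_seq_compl b p
  rw [h, comm_compl b p h] at hb
  have hperp := seq_perp_seq_compl b p
  rw [h, comm_compl b p h] at hperp
  have hx := hF.mul_eq_zero_of_le (seq_le p b) hp1
  have hy := hF.mul_eq_zero_of_le (seq_le (compl p) b) hp2
  have hx' := hF.mul_eq_zero_comm hx
  have hy' := hF.mul_eq_zero_comm hy
  rw [hF.map_compl, mul_sub, mul_one, sub_eq_zero] at hx
  rw [hF.map_compl, sub_mul, one_mul, sub_eq_zero] at hx'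
  rw [← hb, hF.map_oplus _ _ hperp, mul_add, add_mul, hy, hy', ← hx, ← hx']

theorem exists_basis_lift (hF : IsFaithfulRep F) (v : OrthonormalBasis ι ℂ H) :
    ∃ e : ι → E, (∀ i, IsSharp (e i)) ∧ ∀ i, F (e i) = lineProj (v i) := by
  choose e he using fun i => hF.exists_lineProj (v i) (v.norm_eq_one i)
  exact ⟨e, fun i => (he i).1, fun i => (he i).2⟩

/-- Parseval's identity makes every partial sum summable with the next term. The clause on `c`
travels through the induction because it depends on how `x` is assembled, not just on `F x`. -/
theorem exists_sum (hF : IsFaithfulRep F) (he : ∀ i, F (e i) = lineProj (v i)) (s : ι → I) :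
    ∃ x, F x = diagOp v (fun i => s i) ∧ ∀ c, (∀ i, NonInterfering c (e i)) →
      NonInterfering c x ∧ F (seq c x) = ∑ i, ((s i : ℝ) : ℂ) • F (seq c (e i)) := by
  classical
  suffices h : ∀ S : Finset ι, ∃ x, F x = ∑ i ∈ S, ((s i : ℝ) : ℂ) • lineProj (v i) ∧
      ∀ c, (∀ i, NonInterfering c (e i)) →
        NonInterfering c x ∧ F (seq c x) = ∑ i ∈ S, ((s i : ℝ) : ℂ) • F (seq c (e i)) from h _
  intro S
  induction S using Finset.induction_on with
  | empty =>
    refine ⟨0, by simp [hF.map_zero], fun c _ => ⟨comm_of_seq_eq_zero _ _ (seq_zero c), ?_⟩⟩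
    simp [seq_zero, hF.map_zero]
  | insert j S hj ih =>
    obtain ⟨x, hx, hc⟩ := ih
    have hj' : F (s j • e j) = ((s j : ℝ) : ℂ) • lineProj (v j) := by rw [hF.map_smul, he]
    have hp : Perp (s j • e j) x := by
      refine hF.perp_of_le _ _ fun ψ hψ => ?_
      have h1 : ∀ i, (⟪ψ, (((s i : ℝ) : ℂ) • lineProj (v i)) ψ⟫_ℂ).re ≤ ‖⟪v i, ψ⟫_ℂ‖ ^ 2 := by
        intro i
        rw [smul_apply, inner_smul_right, inner_lineProj (v.norm_eq_one i), ← Complex.ofReal_mul,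
          Complex.ofReal_re]
        exact mul_le_of_le_one_left (sq_nonneg _) (s i).2.2
      rw [hj', hx, sum_apply, inner_sum, Complex.re_sum]
      calc _ ≤ ‖⟪v j, ψ⟫_ℂ‖ ^ 2 + ∑ i ∈ S, ‖⟪v i, ψ⟫_ℂ‖ ^ 2 :=
            add_le_add (h1 j) (Finset.sum_le_sum fun i _ => h1 i)
        _ = ∑ i ∈ insert j S, ‖⟪v i, ψ⟫_ℂ‖ ^ 2 :=
            (Finset.sum_insert (f := fun i => ‖⟪v i, ψ⟫_ℂ‖ ^ 2) hj).symm
        _ ≤ ∑ i, ‖⟪v i, ψ⟫_ℂ‖ ^ 2 :=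
            Finset.sum_le_sum_of_subset_of_nonneg (Finset.subset_univ _) fun _ _ _ => sq_nonneg _
        _ = 1 := by rw [v.sum_sq_norm_inner_right, hψ, one_pow]
    refine ⟨oplus (s j • e j) x, ?_, fun c hce => ⟨((hce j).smul _).oplus (hc c hce).1 hp, ?_⟩⟩
    · rw [hF.map_oplus _ _ hp, hj', hx, Finset.sum_insert hj]
    · rw [seq_oplus _ _ _ hp, hF.map_oplus _ _ (seq_perp _ _ _ hp), seq_smul, hF.map_smul,
        (hc c hce).2, Finset.sum_insert hj]

/-- Effects that are diagonal in a common orthonormal basis do not interfere, and their sequential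
product is the product of operators. -/
theorem seq_of_diagOp (hF : IsFaithfulRep F) (v : OrthonormalBasis ι ℂ H) {a b : E} {s t : ι → I}
    (ha : F a = diagOp v fun i => s i) (hb : F b = diagOp v fun i => t i) :
    NonInterfering a b ∧ F (seq a b) = F a * F b := by
  classical
  obtain ⟨e, hsharp, he⟩ := hF.exists_basis_lift v
  have horth : ∀ i j, i ≠ j → seq (e i) (e j) = 0 := by
    intro i j hij
    refine (hsharp i).seq_eq_zero ?_
    have hle : ∀ ψ : H, ‖ψ‖ = 1 → (⟪ψ, F (e i) ψ⟫_ℂ).re + (⟪ψ, F (e j) ψ⟫_ℂ).re ≤ 1 := by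
      intro ψ hψ
      rw [he, he, inner_lineProj (v.norm_eq_one i), inner_lineProj (v.norm_eq_one j),
        Complex.ofReal_re, Complex.ofReal_re, ← Finset.sum_pair (f := fun i => ‖⟪v i, ψ⟫_ℂ‖ ^ 2) hij,
        ← one_pow 2, ← hψ, ← v.sum_sq_norm_inner_right]
      exact Finset.sum_le_sum_of_subset_of_nonneg (Finset.subset_univ _) fun _ _ _ => sq_nonneg _
    exact hF.perp_of_le _ _ hle
  have hcomm : ∀ i j, NonInterfering (e i) (e j) := by
    intro i j
    by_cases hij : i = j
    · rw [hij]; rfl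
    · exact comm_of_seq_eq_zero _ _ (horth i j hij)
  -- Injectivity identifies `x` with the sum assembled from the `e i`.
  have key : ∀ {x : E} {r : ι → I}, F x = diagOp v (fun i => r i) →
      ∀ c, (∀ i, NonInterfering c (e i)) →
        NonInterfering c x ∧ F (seq c x) = ∑ i, ((r i : ℝ) : ℂ) • F (seq c (e i)) := by
    intro x r hx
    obtain ⟨y, hy, h⟩ := hF.exists_sum he r
    rwa [hF.injective (hx.trans hy.symm)]
  have hea : ∀ i, NonInterfering (e i) a ∧ F (seq (e i) a) = ((s i : ℝ) : ℂ) • lineProj (v i) := by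
    intro i
    refine ⟨(key ha _ (hcomm i)).1, ?_⟩
    rw [(key ha _ (hcomm i)).2, Finset.sum_eq_single i, (hsharp i).seq_self, he]
    · intro j _ hji
      rw [horth i j hji.symm, hF.map_zero, _root_.smul_zero]
    · simp
  -- The product is additive only on the right: `a` was expanded with `e i` on the left,
  -- non-interference swaps the factors, and now `b` is expanded.
  obtain ⟨h1, h2⟩ := key hb a fun i => (hea i).1.symm
  refine ⟨h1, ?_⟩
  rw [h2, ha, hb, diagOp_mul, diagOp]
  refine Finset.sum_congr rfl fun i _ => ?_
  rw [← (hea i).1, (hea i).2, _root_.smul_smul, Pi.mul_apply, Complex.ofReal_mul, mul_comm]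

theorem eigenvalue_mem (hF : IsFaithfulRep F) {x : E} {r : ι → ℝ} (hx : F x = diagOp v r) (i : ι) :
    r i ∈ I := by
  classical
  have h : ∀ (y : E) (r : ι → ℝ), F y = diagOp v r → 0 ≤ r i := by
    intro y r hy
    have := hF.inner_nonneg y (v i)
    rwa [hy, diagOp_basis, inner_smul_right, inner_self_eq_norm_sq_to_K, v.norm_eq_one,
      RCLike.ofReal_one, one_pow, mul_one, Complex.ofReal_re] at this
  refine ⟨h x r hx, ?_⟩
  have h1 := h (compl x) (1 - r) (by
    rw [hF.map_compl, hx, sub_eq_iff_eq_add, ← diagOp_add, sub_add_cancel, diagOp_one])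
  simpa using h1

theorem seq_of_commute [FiniteDimensional ℂ H] (hF : IsFaithfulRep F) {a b : E}
    (h : F a * F b = F b * F a) : NonInterfering a b ∧ F (seq a b) = F a * F b := by
  obtain ⟨κ, _, w, s, t, hs, ht⟩ :=
    exists_common_eigenbasis (hF.isSymmetric a) (hF.isSymmetric b) h
  exact hF.seq_of_diagOp w (s := fun i => ⟨s i, hF.eigenvalue_mem hs i⟩)
    (t := fun i => ⟨t i, hF.eigenvalue_mem ht i⟩) hs ht

/-! ### Spectral projections from the closure of non-interference. -/

/-- The effects that are diagonal in the basis `v` with eigenvalues `r` do not interfere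
with `b`. -/
def Good (F : E → H →L[ℂ] H) (v : OrthonormalBasis ι ℂ H) (b : E) (r : ι → ℝ) : Prop :=
  ∃ x, F x = diagOp v r ∧ NonInterfering b x

variable {b : E} {r s : ι → ℝ}

theorem Good.mem (hF : IsFaithfulRep F) (h : Good F v b r) (i : ι) : r i ∈ I := by
  obtain ⟨x, hx, -⟩ := h
  exact hF.eigenvalue_mem hx i

theorem good_one (hF : IsFaithfulRep F) : Good F v b 1 :=
  ⟨1, by rw [hF.map_one, diagOp_one], nonInterfering_one b⟩

theorem Good.compl (hF : IsFaithfulRep F) (h : Good F v b r) : Good F v b (1 - r) := by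
  obtain ⟨x, hx, hb⟩ := h
  refine ⟨_, ?_, hb.compl⟩
  rw [hF.map_compl, hx, sub_eq_iff_eq_add, ← diagOp_add, sub_add_cancel, diagOp_one]

theorem Good.smul (hF : IsFaithfulRep F) (h : Good F v b r) (c : I) :
    Good F v b ((c : ℝ) • r) := by
  obtain ⟨x, hx, hb⟩ := h
  exact ⟨_, by rw [hF.map_smul, hx, diagOp_smul], hb.smul c⟩

theorem Good.mul (hF : IsFaithfulRep F) (h : Good F v b r) (h' : Good F v b s) :
    Good F v b (r * s) := by
  have hr := h.mem hF
  have hs := h'.mem hF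
  obtain ⟨x, hx, hb⟩ := h
  obtain ⟨y, hy, hb'⟩ := h'
  refine ⟨_, ?_, hb.seq hb'⟩
  rw [(hF.seq_of_diagOp v (s := fun i => ⟨r i, hr i⟩) (t := fun i => ⟨s i, hs i⟩) hx hy).2, hx, hy,
    diagOp_mul]

theorem Good.add_half (hF : IsFaithfulRep F) (h : Good F v b r) (h' : Good F v b s) :
    Good F v b ((1 / 2 : ℝ) • (r + s)) := by
  obtain ⟨x, hx, hb⟩ := h
  obtain ⟨y, hy, hb'⟩ := h'
  refine ⟨oplus (half • x) (half • y), ?_, (hb.smul _).oplus (hb'.smul _) (half_perp x y)⟩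
  rw [hF.map_oplus _ _ (half_perp x y), hF.map_smul, hF.map_smul, hx, hy, smul_add, diagOp_add,
    diagOp_smul, diagOp_smul, coe_half]

/-- Allows rescaling upwards: an effect with eigenvalues `r` exists by `exists_sum`, and the
positive scalar cancels under the injective `F`. -/
theorem Good.of_smul (hF : IsFaithfulRep F) {c : I} (hc : 0 < (c : ℝ)) (hr : ∀ i, r i ∈ I)
    (h : Good F v b ((c : ℝ) • r)) : Good F v b r := by
  obtain ⟨x, hx, hb⟩ := h
  obtain ⟨e, -, he⟩ := hF.exists_basis_lift v
  obtain ⟨y, hy, -⟩ := hF.exists_sum he fun i => ⟨r i, hr i⟩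
  have hxy : x = c • y := hF.injective (by rw [hF.map_smul, hx, hy, diagOp_smul])
  refine ⟨y, hy, hF.injective ?_⟩
  rw [hxy, NonInterfering, seq_smul, smul_seq] at hb
  have h1 := congrArg F hb
  rw [hF.map_smul, hF.map_smul] at h1
  exact smul_right_injective _ (by exact_mod_cast hc.ne') h1

/-- Subtraction is unavailable, so the square is reached through complements and midpoints that stay
in the unit interval. -/
theorem Good.sq_sub (hF : IsFaithfulRep F) (h : Good F v b r) {c : ℝ} (hc : c ∈ I) :
    Good F v b fun i => (r i - c) ^ 2 := by
  have hmem : ∀ i, (r i - c) ^ 2 ∈ I := fun i => by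
    obtain ⟨h0, h1⟩ := h.mem hF i
    obtain ⟨h2, h3⟩ := hc
    constructor <;> nlinarith
  have g1 := (h.mul hF h).compl hF
  have g2 := ((good_one hF (v := v) (b := b)).smul hF ⟨c, hc⟩)
  have g3 := (g2.mul hF g2).compl hF
  have g4 := g1.add_half hF g3
  have g5 := (h.smul hF ⟨c, hc⟩).add_half hF (good_one hF)
  -- Here `g4` is `1 - (r² + c²)/2` and `g5` is `(c r + 1)/2`, so `g6` is half of `1 - (r - c)²/4`.
  have g6 := (g4.smul hF half).add_half hF g5
  have g7 : Good F v b fun i => 1 - (r i - c) ^ 2 / 4 := by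
    refine Good.of_smul hF (c := half) (by norm_num [coe_half]) (fun i => ?_) ?_
    · obtain ⟨h0, h1⟩ := hmem i
      constructor <;> linarith
    · convert g6 using 1
      funext i
      simp only [Pi.smul_apply, Pi.sub_apply, Pi.add_apply, Pi.mul_apply, Pi.one_apply,
        smul_eq_mul, coe_half]
      ring
  refine Good.of_smul hF (c := ⟨1 / 4, by norm_num, by norm_num⟩) (by norm_num) hmem ?_
  convert g7.compl hF using 1
  funext i
  simp only [Pi.smul_apply, Pi.sub_apply, Pi.one_apply, smul_eq_mul]
  ring

theorem Good.prod (hF : IsFaithfulRep F) {κ : Type*} (S : Finset κ) {f : κ → ι → ℝ}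
    (h : ∀ k ∈ S, Good F v b (f k)) : Good F v b (∏ k ∈ S, f k) := by
  classical
  induction S using Finset.induction_on with
  | empty => exact good_one hF
  | insert k S hk ih =>
    rw [Finset.prod_insert hk]
    exact (h k (Finset.mem_insert_self k S)).mul hF
      (ih fun l hl => h l (Finset.mem_insert_of_mem hl))

/-- The spectral projections of an effect that does not interfere with `b` do not interfere
with `b`. -/
theorem Good.indicator [DecidableEq ℝ] (hF : IsFaithfulRep F) (h : Good F v b r) (j : ι) :
    Good F v b fun i => if r i = r j then 1 else 0 := by
  classical
  -- Lagrange interpolation with squared factors, which remain in the unit interval: the product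
  -- over the other eigenvalues vanishes at them and is positive at `r j`, and that constant is
  -- divided out.
  set S := (Finset.univ.image r).erase (r j)
  have hg : Good F v b (∏ c ∈ S, fun i => (r i - c) ^ 2) := by
    refine Good.prod hF S fun c hc => h.sq_sub hF ?_
    obtain ⟨k, -, rfl⟩ := Finset.mem_image.1 (Finset.mem_of_mem_erase hc)
    exact h.mem hF k
  have hpos : 0 < ∏ c ∈ S, (r j - c) ^ 2 := Finset.prod_pos fun c hc => by
    have := Finset.ne_of_mem_erase hc
    have : r j - c ≠ 0 := sub_ne_zero.2 this.symm
    positivity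
  have hmem := hg.mem hF j
  rw [Finset.prod_apply] at hmem
  refine Good.of_smul hF (c := ⟨_, hmem⟩) hpos (fun i => ?_) ?_
  · split_ifs <;> simp
  · convert hg using 1
    funext i
    rw [Finset.prod_apply, Pi.smul_apply, smul_eq_mul]
    split_ifs with hi
    · rw [hi, mul_one]
    · rw [mul_zero, eq_comm]
      exact Finset.prod_eq_zero (i := r i) (Finset.mem_erase.2 ⟨hi, by simp⟩) (by simp)

theorem commute_of_nonInterfering (hF : IsFaithfulRep F) {a b : E} (h : NonInterfering a b) :
    F a * F b = F b * F a := by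
  classical
  obtain ⟨κ, _, w, s, hs⟩ := hF.exists_diag a
  have hgood : Good F w b (fun i => s i) := ⟨a, hs, h.symm⟩
  have hproj : ∀ j, diagOp w (fun i => if (s i : ℝ) = s j then 1 else 0) * F b =
      F b * diagOp w (fun i => if (s i : ℝ) = s j then 1 else 0) := by
    intro j
    obtain ⟨p, hp, hbp⟩ := hgood.indicator hF j
    rw [← hp]
    refine hF.commute_of_nonInterfering_proj ?_ hbp
    rw [hp, diagOp_mul]
    congr 1
    funext i
    simp
  -- Summing over distinct eigenvalues, not basis indices, uses only the full spectral projections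
  -- covered by `hproj`.
  have hsum : F a = ∑ c ∈ Finset.univ.image (fun i => (s i : ℝ)),
      (c : ℂ) • diagOp w (fun i => if (s i : ℝ) = c then 1 else 0) := by
    rw [hs]
    symm
    rw [eq_diagOp_iff]
    intro j
    rw [sum_apply, Finset.sum_eq_single (s j : ℝ)]
    · simp [diagOp_basis]
    · intro c _ hc
      simp [diagOp_basis, hc.symm]
    · simp
  rw [hsum, Finset.sum_mul, Finset.mul_sum]
  refine Finset.sum_congr rfl fun c hc => ?_
  obtain ⟨j, -, rfl⟩ := Finset.mem_image.1 hc
  rw [smul_mul_assoc, hproj, mul_smul_comm]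

end IsFaithfulRep

theorem lemma4p5 {E : Type*} [ConvexSEA E]
    (hs : ConvexEffectAlgebra.IsSpectral E)
    (hat : ConvexEffectAlgebra.S1 E → EffectAlgebra.State E)
    (hat_self : ∀ a : ConvexEffectAlgebra.S1 E, (hat a).toFun a.1 = 1)
    (U : ∀ A B : ConvexEffectAlgebra.Context E,
      ConvexEffectAlgebra.StateSpace A ≃ₗᵢ[ℂ] ConvexEffectAlgebra.StateSpace B)
    (hU : ConvexEffectAlgebra.IsComplete hat U)
    (B : ConvexEffectAlgebra.Context E) (a b : E) :
    (ConvexSEA.NonInterfering a b ↔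
      ConvexEffectAlgebra.J hs U B a * ConvexEffectAlgebra.J hs U B b =
        ConvexEffectAlgebra.J hs U B b * ConvexEffectAlgebra.J hs U B a) ∧
    (ConvexSEA.NonInterfering a b →
      ConvexEffectAlgebra.J hs U B (ConvexSEA.seq a b) =
        ConvexEffectAlgebra.J hs U B a * ConvexEffectAlgebra.J hs U B b) := by
  have hF := isFaithfulRep_J hs hat_self hU B
  exact ⟨⟨hF.commute_of_nonInterfering, fun h => (hF.seq_of_commute h).1⟩,
    fun h => (hF.seq_of_commute (hF.commute_of_nonInterfering h)).2⟩
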